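/- Let $G$ be a (connected) semisimple algebraic group over $\mathbb{C}$, $T\subseteq G$ a maximal torus, $B\supseteq T$ a Borel subgroup, $X$ the lattice of coweights (cocharacters of $T$), $X_+\subseteq X$ the dominant coweights with respect to $B$, and $2\rho$ the sum of the positive roots. For each root $\alpha$ let $x_\alpha:\mathbb{G}_a\to G$ be a root subgroup for $\alpha$, and let $\psi:G\to G$ be the transpose-inverse involution, i.e. the involutive automorphism of $G$ with $\psi(s)=s^{-1}$ for $s\in T$ and $\psi(x_\alpha(a))=x_{-\alpha}(-a)$ for all roots $\alpha$ (the $x_\alpha$ being normalized so that it exists). Let $\mathcal{K}=\mathbb{C}((t))$, $\mathcal{O}=\mathbb{C}[[t]]$, and let $\mathrm{Gr}=G(\mathcal{K})/G(\mathcal{O})$ be the affine Grassmannian, with the points $t^\mu\in \mathrm{Gr}$ for $\mu\in X$; the automorphism $\psi$ extends to $G(\mathcal{K})$ and to $\mathrm{Gr}$. Let $d:\mathrm{Gr}\times\mathrm{Gr}\to X_+$ be the distance function whose level sets are the $G(\mathcal{K})$-orbits, with $d(1,t^\lambda)=\lambda$ for $\lambda\in X_+$. For $\lambda,\mu\in X_+$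 let $m_{\lambda\mu}$ be the map $(L_1,L_2)\mapsto L_2$ on the convolution variety $\{(L_1,L_2) : d(1,L_1)=\lambda,\ d(L_1,L_2)=\mu\}$. For $\nu\in X$ the fibre $m_{\lambda\mu}^{-1}(t^\nu)$ is identified with the subvariety $$m_{\lambda\mu}^{-1}(t^\nu)=\{L\in\mathrm{Gr} : d(1,L)=\lambda,\ d(L,t^\nu)=\mu\}$$ of $\mathrm{Gr}$, and $C_{\lambda\mu}^\nu$ denotes the set of its irreducible components of dimension $\langle\lambda+\mu-\nu,\rho\rangle$. Let $\lambda,\mu\in X_+$ and $\nu\in X$. If $L\in m_{\lambda\mu}^{-1}(t^\nu)$, then $t^\nu\psi(L)\in m_{\mu\lambda}^{-1}(t^\nu)$, and the map $L\mapsto t^\nu\psi(L)$ is an isomorphism of varieties $m_{\lambda\mu}^{-1}(t^\nu)\to m_{\mu\lambda}^{-1}(t^\nu)$. Consequently $Z\mapsto t^\nu\psi(Z)$ is a bijection $C_{\lambda\mu}^\nu\to C_{\mu\lambda}^\nu$. -/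

import Mathlib

open Topology

namespace Satake

noncomputable section

/-! ## Affine algebraic groups through their coordinate Hopf algebras

An affine algebraic group `G` over `ℂ` is given by its coordinate ring `A = ℂ[G]`, a commutative
Hopf algebra of finite type over `ℂ`. -/

/-- The group `G(R) = Hom(A, R)` of `R`-points of the group with coordinate ring `A`. -/
def Points (A : Type*) [CommRing A] [HopfAlgebra ℂ A] (R : Type*) [CommRing R] [Algebra ℂ R] :
    Type _ :=
  A →ₐ[ℂ] R

section Points

variable {A A' : Type*} [CommRing A] [HopfAlgebra ℂ A] [CommRing A'] [HopfAlgebra ℂ A']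
  {R S : Type*} [CommRing R] [Algebra ℂ R] [CommRing S] [Algebra ℂ S]

instance : FunLike (Points A R) A R := inferInstanceAs (FunLike (A →ₐ[ℂ] R) A R)

/-- A point of `G`, as a homomorphism of `ℂ`-algebras. -/
def Points.toAlgHom (g : Points A R) : A →ₐ[ℂ] R := g

/-- A homomorphism of `ℂ`-algebras `ℂ[G] → R`, as a point of `G`. -/
def Points.ofAlgHom (g : A →ₐ[ℂ] R) : Points A R := g

/-- The product is convolution, `(g * h)(a) = ∑ g(a₍₁₎) h(a₍₂₎)`, the unit is the counit, and the
inverse is composition with the antipode. -/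
instance : Group (Points A R) where
  mul g h := Points.ofAlgHom
    (WithConv.toConv g.toAlgHom * WithConv.toConv h.toAlgHom : WithConv (A →ₐ[ℂ] R)).ofConv
  one := Points.ofAlgHom (1 : WithConv (A →ₐ[ℂ] R)).ofConv
  inv g := Points.ofAlgHom (g.toAlgHom.comp (HopfAlgebra.antipodeAlgHom ℂ A))
  mul_assoc f g h := congrArg WithConv.ofConv
    (mul_assoc (WithConv.toConv f.toAlgHom) (WithConv.toConv g.toAlgHom)
      (WithConv.toConv h.toAlgHom))
  one_mul g := congrArg WithConv.ofConv (one_mul (WithConv.toConv g.toAlgHom))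
  mul_one g := congrArg WithConv.ofConv (mul_one (WithConv.toConv g.toAlgHom))
  inv_mul_cancel g := by
    have h := AlgHom.comp_convMul_distrib g.toAlgHom
      (WithConv.toConv (HopfAlgebra.antipodeAlgHom ℂ A)) (WithConv.toConv (AlgHom.id ℂ A))
    rw [AlgHom.antipode_id_cancel] at h
    refine Eq.trans h.symm ?_
    apply AlgHom.ext
    intro a
    change g.toAlgHom ((1 : WithConv (A →ₐ[ℂ] A)) a) = (1 : WithConv (A →ₐ[ℂ] R)) a
    rw [AlgHom.convOne_apply, AlgHom.convOne_apply, AlgHom.commutes]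

/-- The homomorphism `G(R) → G(S)` induced by a homomorphism of `ℂ`-algebras `R → S`. -/
def Points.map (A : Type*) [CommRing A] [HopfAlgebra ℂ A] (h : R →ₐ[ℂ] S) :
    Points A R →* Points A S :=
  MonoidHom.mk' (fun g => Points.ofAlgHom (h.comp g.toAlgHom)) (fun f g =>
    AlgHom.comp_convMul_distrib h (WithConv.toConv f.toAlgHom) (WithConv.toConv g.toAlgHom))

/-- The homomorphism `G'(R) → G(R)` given by a homomorphism of algebraic groups `G' → G`, that is,
by a homomorphism of Hopf algebras `ℂ[G] → ℂ[G']`. -/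
def Points.comap (f : A →ₐc[ℂ] A') (R : Type*) [CommRing R] [Algebra ℂ R] :
    Points A' R →* Points A R :=
  MonoidHom.mk' (fun g => Points.ofAlgHom (g.toAlgHom.comp (f : A →ₐ[ℂ] A'))) (fun g h =>
    AlgHom.convMul_comp_bialgHom_distrib (WithConv.toConv g.toAlgHom)
      (WithConv.toConv h.toAlgHom) f)

end Points

section Group

variable (A : Type*) [CommRing A] [HopfAlgebra ℂ A]

/-- The Zariski topology on `G(ℂ)`. -/
abbrev zariski : TopologicalSpace (Points A ℂ) :=
  TopologicalSpace.generateFrom {U | ∃ a : A, U = {g : Points A ℂ | g a ≠ 0}}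

variable {A} in
/-- Closed connected solvable subgroups of `G(ℂ)`. -/
def IsClosedConnectedSolvable (H : Subgroup (Points A ℂ)) : Prop :=
  IsClosed[zariski A] (H : Set (Points A ℂ)) ∧
    @IsConnected _ (zariski A) (H : Set (Points A ℂ)) ∧ Group.IsSolvable H

/-- `G` is semisimple: it is connected and its radical is trivial, that is, the only closed connected
solvable normal subgroup is the trivial one. -/
def IsSemisimpleGroup : Prop :=
  IsDomain A ∧ ∀ H : Subgroup (Points A ℂ), H.Normal → IsClosedConnectedSolvable H → H = ⊥

variable {A} in
/-- Borel subgroups: maximal closed connected solvable subgroups. -/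
def IsBorel (B : Subgroup (Points A ℂ)) : Prop :=
  IsClosedConnectedSolvable B ∧
    ∀ H : Subgroup (Points A ℂ), IsClosedConnectedSolvable H → B ≤ H → H = B

end Group

/-! ## Tori, roots and root subgroups

A closed subtorus `T ⊆ G` with character lattice `M` is a surjective homomorphism of Hopf algebras
`ℂ[G] → ℂ[T] = ℂ[M]`. Coweights are the cocharacters of `T`, i.e. the elements of `Hom(M, ℤ)`. -/

section Torus

variable {A : Type*} [CommRing A] [HopfAlgebra ℂ A] {M : Type*} [AddCommGroup M]

/-- `T` is a closed torus in `G` which is not properly contained in another one. -/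
def IsMaximalTorus (T : A →ₐc[ℂ] AddMonoidAlgebra ℂ M) : Prop :=
  Function.Surjective T ∧
    ∀ (n : ℕ) (T' : A →ₐc[ℂ] AddMonoidAlgebra ℂ (Fin n → ℤ)), Function.Surjective T' →
      (∀ a, T' a = 0 → T a = 0) → ∀ a, T a = 0 → T' a = 0

/-- The value `α(s)` of the character `α` at the point `s` of the torus. -/
def charValue (α : M) (s : Points (AddMonoidAlgebra ℂ M) ℂ) : ℂ :=
  s (AddMonoidAlgebra.single α 1)

/-- Elements of the Lie algebra of `G`: point derivations of `ℂ[G]` at the identity. -/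
def IsPointDerivation (D : A →ₗ[ℂ] ℂ) : Prop :=
  ∀ a b : A, D (a * b) = Coalgebra.counit (R := ℂ) a * D b + D a * Coalgebra.counit (R := ℂ) b

/-- The adjoint action of `g ∈ G(ℂ)`:
`(Ad(g) D)(a) = ∑ g(a₍₁₎) D(a₍₂₎) g⁻¹(a₍₃₎)`, a product in the convolution algebra. -/
def adjointAction (g : Points A ℂ) (D : A →ₗ[ℂ] ℂ) : A →ₗ[ℂ] ℂ :=
  (WithConv.toConv g.toAlgHom.toLinearMap * WithConv.toConv D *
    WithConv.toConv (g⁻¹).toAlgHom.toLinearMap).ofConv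

/-- The roots of `G` with respect to `T`: the nonzero weights of `T` on the Lie algebra of `G`. -/
def roots (T : A →ₐc[ℂ] AddMonoidAlgebra ℂ M) : Set M :=
  {α | α ≠ 0 ∧ ∃ D : A →ₗ[ℂ] ℂ, IsPointDerivation D ∧ D ≠ 0 ∧
    ∀ s : Points (AddMonoidAlgebra ℂ M) ℂ,
      adjointAction (Points.comap T ℂ s) D = charValue α s • D}

/-- `x : 𝔾ₐ → G` is a root subgroup for `α`: an injective homomorphism of algebraic groups with
`s x(c) s⁻¹ = x(α(s) c)` for `s ∈ T`. -/
structure IsRootSubgroup (T : A →ₐc[ℂ] AddMonoidAlgebra ℂ M) (α : M)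
    (x : Multiplicative ℂ →* Points A ℂ) : Prop where
  injective : Function.Injective x
  algebraic : ∀ a : A, ∃ p : Polynomial ℂ, ∀ c : ℂ, x (Multiplicative.ofAdd c) a = p.eval c
  conj : ∀ (s : Points (AddMonoidAlgebra ℂ M) ℂ) (c : ℂ),
    Points.comap T ℂ s * x (Multiplicative.ofAdd c) * (Points.comap T ℂ s)⁻¹ =
      x (Multiplicative.ofAdd (charValue α s * c))

/-- The roots which are positive with respect to the Borel subgroup `B ⊇ T`: those whose root
subgroup is contained in `B` (equivalently in its unipotent radical `N`). -/
def positiveRoots (T : A →ₐc[ℂ] AddMonoidAlgebra ℂ M) (B : Subgroup (Points A ℂ)) : Set M :=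
  {α | α ∈ roots T ∧ ∃ x, IsRootSubgroup T α x ∧ x.range ≤ B}

/-- Dominant coweights. -/
def IsDominant (T : A →ₐc[ℂ] AddMonoidAlgebra ℂ M) (B : Subgroup (Points A ℂ)) (l : M →+ ℤ) : Prop :=
  ∀ α ∈ positiveRoots T B, 0 ≤ l α

/-- The integer `⟨l, 2ρ⟩`, where `2ρ` is the sum of the positive roots. (The set of roots is finite,
because the Lie algebra of `G` is finite-dimensional.) -/
def pairingTwoRho (T : A →ₐc[ℂ] AddMonoidAlgebra ℂ M) (B : Subgroup (Points A ℂ)) (l : M →+ ℤ) : ℤ :=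
  ∑ᶠ α ∈ positiveRoots T B, l α

/-- `ψ` is the transpose-inverse involution of `G` attached to `T` and the root subgroups `x α`:
the involutive automorphism with `ψ(s) = s⁻¹` for `s ∈ T` (on coordinate rings: restriction to `T`
after `ψ` is the antipode of `ℂ[T]` after restriction to `T`) and `ψ(x_α(c)) = x_{-α}(-c)`
for all roots `α`. -/
structure IsTransposeInverse (T : A →ₐc[ℂ] AddMonoidAlgebra ℂ M)
    (x : M → Multiplicative ℂ →* Points A ℂ) (ψ : A ≃ₐc[ℂ] A) : Prop where
  involutive : ∀ a : A, ψ (ψ a) = a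
  torus : ∀ a : A, T (ψ a) = HopfAlgebra.antipode ℂ (T a)
  root : ∀ α ∈ roots T, ∀ c : ℂ,
    Points.comap (ψ : A →ₐc[ℂ] A) ℂ (x α (Multiplicative.ofAdd c)) =
      x (-α) (Multiplicative.ofAdd (-c))

end Torus

/-! ## The affine Grassmannian -/

section Grassmannian

variable (A : Type*) [CommRing A] [HopfAlgebra ℂ A]

/-- `G(𝒦)` for `𝒦 = ℂ((t))`. -/
abbrev LoopGroup : Type _ := Points A (LaurentSeries ℂ)

/-- The inclusion `ℂ[[t]] → ℂ((t))`. -/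
def powerSeriesToLaurent : PowerSeries ℂ →ₐ[ℂ] LaurentSeries ℂ :=
  { HahnSeries.ofPowerSeries ℤ ℂ with commutes' := fun _ => rfl }

/-- `G(𝒪)` for `𝒪 = ℂ[[t]]`, as a subgroup of `G(𝒦)`. -/
def arcGroup : Subgroup (LoopGroup A) := (Points.map A powerSeriesToLaurent).range

/-- The affine Grassmannian `Gr = G(𝒦) / G(𝒪)`. -/
def Gr : Type _ := LoopGroup A ⧸ arcGroup A

instance : MulAction (LoopGroup A) (Gr A) :=
  inferInstanceAs (MulAction (LoopGroup A) (LoopGroup A ⧸ arcGroup A))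

variable {A}

/-- The projection `G(𝒦) → Gr`. -/
def toGr (g : LoopGroup A) : Gr A := (QuotientGroup.mk g : LoopGroup A ⧸ arcGroup A)

/-- The action on `Gr` of an automorphism `ψ` of `G`. -/
def Gr.mapAut (ψ : A ≃ₐc[ℂ] A) : Gr A → Gr A :=
  Quotient.map' (Points.comap (ψ : A →ₐc[ℂ] A) (LaurentSeries ℂ)) (by
    intro g h hgh
    rw [QuotientGroup.leftRel_apply] at hgh ⊢
    obtain ⟨k, hk⟩ := hgh
    refine ⟨Points.comap (ψ : A →ₐc[ℂ] A) (PowerSeries ℂ) k, ?_⟩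
    rw [← map_inv, ← map_mul, ← hk]
    rfl)

/-! ### The ind-variety structure

`G(𝒦)` is the increasing union of the pieces where the orders of the poles of all functions are
bounded; on every piece the coefficients `g ↦ (coefficient of tⁿ in g(a))`, for `a ∈ ℂ[G]` and
`n ∈ ℤ`, are coordinates. `Gr` carries the quotient topology, and a function on a subset of `Gr` is
regular if its pull-back to `G(𝒦)` is, on each piece, locally a quotient of polynomials in the
coordinates. -/

/-- Polynomials in the coefficient functions on `G(𝒦)`. -/
def coordinateRing (A : Type*) [CommRing A] [HopfAlgebra ℂ A] : Subalgebra ℂ (LoopGroup A → ℂ) :=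
  Algebra.adjoin ℂ {F | ∃ (a : A) (n : ℤ), F = fun g => (g a).coeff n}

/-- The piece of `G(𝒦)` on which `g(a)` has a pole of order at most `b a`, for all `a`. -/
def boundedPiece (b : A → ℕ) : Set (LoopGroup A) :=
  {g | ∀ (a : A) (n : ℤ), n < -(b a : ℤ) → (g a).coeff n = 0}

/-- The Zariski topology on a bounded piece of `G(𝒦)`. -/
abbrev boundedPieceTopology (b : A → ℕ) : TopologicalSpace (boundedPiece b) :=
  TopologicalSpace.generateFrom {U | ∃ p ∈ coordinateRing A, U = {g | p g.1 ≠ 0}}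

/-- The topology of the ind-scheme `G(𝒦)`: a set is closed if it meets every bounded piece in a
Zariski closed set. -/
abbrev loopTopology (A : Type*) [CommRing A] [HopfAlgebra ℂ A] : TopologicalSpace (LoopGroup A) :=
  ⨆ b : A → ℕ, TopologicalSpace.coinduced Subtype.val (boundedPieceTopology b)

/-- The Zariski topology of `Gr`. -/
instance : TopologicalSpace (Gr A) := TopologicalSpace.coinduced toGr (loopTopology A)

/-- The function `F` on the subvariety `Y` of `Gr` is regular on the subset `V` of `Y`. -/
def IsRegularOn {Y : Set (Gr A)} (V : Set Y) (F : Y → ℂ) : Prop :=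
  ∀ (b : A → ℕ), ∀ g ∈ boundedPiece b, (∃ y ∈ V, y.1 = toGr g) →
    ∃ p ∈ coordinateRing A, ∃ q ∈ coordinateRing A, q g ≠ 0 ∧
      ∀ h ∈ boundedPiece b, q h ≠ 0 → ∀ y ∈ V, y.1 = toGr h → F y = p h / q h

/-- `e` is an isomorphism of varieties: a homeomorphism which identifies the regular functions on
open subsets. -/
def IsVarietyIso {Y Z : Set (Gr A)} (e : Y → Z) : Prop :=
  IsHomeomorph e ∧ ∀ V : Set Z, IsOpen V → ∀ F : Z → ℂ,
    IsRegularOn V F ↔ IsRegularOn (e ⁻¹' V) (F ∘ e)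

/-! ### Distance and convolution -/

variable {M : Type*} [AddCommGroup M]

/-- The element `t^l ∈ T(𝒦)`, at which the character `m` takes the value `t^{l(m)}`. -/
def torusElement (l : M →+ ℤ) : Points (AddMonoidAlgebra ℂ M) (LaurentSeries ℂ) :=
  Points.ofAlgHom <| AddMonoidAlgebra.lift ℂ (LaurentSeries ℂ) M
    { toFun := fun m => HahnSeries.single (l m.toAdd) 1
      map_one' := by simp
      map_mul' := fun m n => by simp [HahnSeries.single_mul_single] }

/-- The element `t^l ∈ G(𝒦)`. -/
def tPow (T : A →ₐc[ℂ] AddMonoidAlgebra ℂ M) (l : M →+ ℤ) : LoopGroup A :=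
  Points.comap T (LaurentSeries ℂ) (torusElement l)

/-- `d(L₁, L₂) = l`, where `d` is the distance function on `Gr × Gr` whose level sets are the
`G(𝒦)`-orbits, normalized by `d(1, t^l) = l` for dominant `l`. -/
def HasDistance (T : A →ₐc[ℂ] AddMonoidAlgebra ℂ M) (L₁ L₂ : Gr A) (l : M →+ ℤ) : Prop :=
  ∃ g : LoopGroup A, g • toGr 1 = L₁ ∧ g • toGr (tPow T l) = L₂

/-- The convolution variety: all `(L₁, L₂)` with `d(1, L₁) = l` and `d(L₁, L₂) = m`. -/
def convolutionVariety (T : A →ₐc[ℂ] AddMonoidAlgebra ℂ M) (l m : M →+ ℤ) : Set (Gr A × Gr A) :=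
  {p | HasDistance T (toGr 1) p.1 l ∧ HasDistance T p.1 p.2 m}

/-- The fibre over `t^n` of the convolution morphism `(L₁, L₂) ↦ L₂`; its points `(L, t^n)` are
identified with `L ∈ Gr`. -/
def convolutionFibre (T : A →ₐc[ℂ] AddMonoidAlgebra ℂ M) (l m n : M →+ ℤ) : Set (Gr A) :=
  {L | (L, toGr (tPow T n)) ∈ convolutionVariety T l m}

/-- The set of irreducible components of dimension `⟨l + m - n, ρ⟩` of the fibre over `t^n`. -/
def components (T : A →ₐc[ℂ] AddMonoidAlgebra ℂ M) (B : Subgroup (Points A ℂ)) (l m n : M →+ ℤ) :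
    Set (Set (convolutionFibre T l m n)) :=
  {Z | Z ∈ irreducibleComponents (convolutionFibre T l m n) ∧
    ∃ d : ℕ, topologicalKrullDim Z = d ∧ 2 * (d : ℤ) = pairingTwoRho T B (l + m - n)}

end Grassmannian

end

end Satake

/-! Since `ψ` inverts `T`, it sends `t^l` to its inverse. If `(L₁, L₂) = g • (1, t^l)`, then
`(ψ(L₂), ψ(L₁)) = ψ(g t^l) • (1, t^l)`, so `ψ` reverses distances (`HasDistance.mapAut`). It carries
the chain `1, L, t^n` to `t^{-n}, ψ(L), 1` read backwards; translation by `t^n` yields `1, t^n ψ(L),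
t^n` with the two distances exchanged. The map `L ↦ t^n ψ(L)` is an involution of `Gr`, so it is its
own inverse between the two fibres.

For the geometry, the map lifts to `g ↦ t^n ψ(g)` on `G(𝒦)`, which is polynomial in the coefficients
on each bounded piece. Such a lift gives continuity and pulls regular functions back to regular
functions. Components then correspond because a homeomorphism preserves irreducible components and
Krull dimension. -/

namespace Satake

/-! ### Piecewise polynomial maps of the loop group and regularity on `Gr` -/

section PiecewisePolynomial

variable {A : Type*} [CommRing A] [HopfAlgebra ℂ A]

theorem Points.mul_apply {R : Type*} [CommRing R] [Algebra ℂ R] (g h : Points A R) (a : A) :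
    (g * h) a = ∑ i ∈ (Coalgebra.Repr.arbitrary ℂ a).index,
      g ((Coalgebra.Repr.arbitrary ℂ a).left i) * h ((Coalgebra.Repr.arbitrary ℂ a).right i) :=
  (Coalgebra.Repr.arbitrary ℂ a).convMul_apply
    (WithConv.toConv g.toAlgHom.toLinearMap) (WithConv.toConv h.toAlgHom.toLinearMap)

theorem coeff_mul_eq_zero_of_lt {x y : LaurentSeries ℂ} {N : ℕ}
    (hy : ∀ n : ℤ, n < -(N : ℤ) → y.coeff n = 0) {n : ℤ}
    (hn : n < -((x.order.natAbs + N : ℕ) : ℤ)) : (x * y).coeff n = 0 := by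
  rw [HahnSeries.coeff_mul]
  refine Finset.sum_eq_zero fun ij hij => ?_
  rw [Finset.mem_antidiagonal] at hij
  -- Either the first exponent lies below the order of `x`, or the second is forced below `-N`.
  by_cases h : ij.1 < x.order
  · rw [HahnSeries.coeff_eq_zero_of_lt_order h, zero_mul]
  · rw [hy ij.2 (by omega), mul_zero]

/-- The bound on poles puts the support of every such `y` in `[-N, ∞)`, so one finite index set
serves all `y`. This uniformity is what makes left multiplication polynomial on a whole bounded
piece. -/
theorem coeff_mul_eq_sum (x : LaurentSeries ℂ) (N : ℕ) (n : ℤ) :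
    ∃ s : Finset (ℤ × ℤ), ∀ y : LaurentSeries ℂ, (∀ n : ℤ, n < -(N : ℤ) → y.coeff n = 0) →
      (x * y).coeff n = ∑ ij ∈ s, x.coeff ij.1 * y.coeff ij.2 := by
  have hs : (Set.Ici (-(N : ℤ))).IsPWO := bddBelow_Ici.isWF.isPWO
  refine ⟨Finset.antidiagonal x.isPWO_support hs n, fun y hy => ?_⟩
  refine HahnSeries.coeff_mul_right' hs fun j hj => ?_
  by_contra h
  exact hj (hy j (not_le.mp h))

/-- A self-map of `G(𝒦)` which maps bounded pieces to bounded pieces and which is given by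
polynomials in the coefficient functions on each of them. -/
structure IsPiecewisePolynomial (Φ : LoopGroup A → LoopGroup A) : Prop where
  bounded : ∀ b, ∃ b', Set.MapsTo Φ (boundedPiece b) (boundedPiece b')
  polynomial : ∀ b, ∀ p ∈ coordinateRing A, ∃ p' ∈ coordinateRing A,
    ∀ g ∈ boundedPiece b, p (Φ g) = p' g

/-- It suffices to check polynomiality on the coefficient functions. -/
theorem IsPiecewisePolynomial.of_coeff {Φ : LoopGroup A → LoopGroup A}
    (bounded : ∀ b, ∃ b', Set.MapsTo Φ (boundedPiece b) (boundedPiece b'))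
    (coeff : ∀ b (a : A) (n : ℤ), ∃ p' ∈ coordinateRing A,
      ∀ g ∈ boundedPiece b, (Φ g a).coeff n = p' g) :
    IsPiecewisePolynomial Φ where
  bounded := bounded
  polynomial b p hp := by
    induction hp using Algebra.adjoin_induction with
    | mem p hp =>
      obtain ⟨a, n, rfl⟩ := hp
      exact coeff b a n
    | algebraMap c =>
      exact ⟨algebraMap ℂ _ c, Subalgebra.algebraMap_mem _ c, fun _ _ => rfl⟩
    | add p q _ _ hp hq =>
      obtain ⟨p', hp', hp⟩ := hp
      obtain ⟨q', hq', hq⟩ := hq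
      exact ⟨p' + q', add_mem hp' hq', fun g hg => congrArg₂ (· + ·) (hp g hg) (hq g hg)⟩
    | mul p q _ _ hp hq =>
      obtain ⟨p', hp', hp⟩ := hp
      obtain ⟨q', hq', hq⟩ := hq
      exact ⟨p' * q', mul_mem hp' hq', fun g hg => congrArg₂ (· * ·) (hp g hg) (hq g hg)⟩

theorem coeff_mem_coordinateRing (a : A) (n : ℤ) :
    (fun g : LoopGroup A => (g a).coeff n) ∈ coordinateRing A :=
  Algebra.subset_adjoin ⟨a, n, rfl⟩

theorem isPiecewisePolynomial_comap (ψ : A →ₐc[ℂ] A) :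
    IsPiecewisePolynomial (Points.comap ψ (LaurentSeries ℂ)) :=
  .of_coeff (fun b => ⟨fun a => b (ψ a), fun _ hg a n hn => hg (ψ a) n hn⟩)
    fun _ a n => ⟨_, coeff_mem_coordinateRing (ψ a) n, fun _ _ => rfl⟩

theorem isPiecewisePolynomial_mul_left (g₀ : LoopGroup A) :
    IsPiecewisePolynomial (fun g => g₀ * g) := by
  refine .of_coeff (fun b => ?_) fun b a n => ?_
  -- The sum of the pole bounds of all terms of the comultiplication is a crude upper bound for each
  -- of them.
  · refine ⟨fun a => ∑ i ∈ (Coalgebra.Repr.arbitrary ℂ a).index,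
      ((g₀ ((Coalgebra.Repr.arbitrary ℂ a).left i)).order.natAbs +
        b ((Coalgebra.Repr.arbitrary ℂ a).right i)), fun g hg a n hn => ?_⟩
    rw [Points.mul_apply, HahnSeries.coeff_sum]
    refine Finset.sum_eq_zero fun i hi => ?_
    refine coeff_mul_eq_zero_of_lt (hg _) (hn.trans_le ?_)
    rw [neg_le_neg_iff, Nat.cast_le]
    exact Finset.single_le_sum
      (f := fun i => (g₀ ((Coalgebra.Repr.arbitrary ℂ a).left i)).order.natAbs +
        b ((Coalgebra.Repr.arbitrary ℂ a).right i)) (fun _ _ => Nat.zero_le _) hi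
  · choose s hs using fun i => coeff_mul_eq_sum (g₀ ((Coalgebra.Repr.arbitrary ℂ a).left i))
      (b ((Coalgebra.Repr.arbitrary ℂ a).right i)) n
    refine ⟨∑ i ∈ (Coalgebra.Repr.arbitrary ℂ a).index, ∑ jk ∈ s i,
      (g₀ ((Coalgebra.Repr.arbitrary ℂ a).left i)).coeff jk.1 •
        fun g : LoopGroup A => (g ((Coalgebra.Repr.arbitrary ℂ a).right i)).coeff jk.2,
      sum_mem fun i _ => sum_mem fun jk _ =>
        Subalgebra.smul_mem _ (coeff_mem_coordinateRing _ _) _, fun g hg => ?_⟩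
    rw [Points.mul_apply, HahnSeries.coeff_sum, Finset.sum_apply]
    refine Finset.sum_congr rfl fun i _ => ?_
    rw [hs i _ (hg _), Finset.sum_apply]
    rfl

theorem IsPiecewisePolynomial.comp {Φ Φ' : LoopGroup A → LoopGroup A}
    (h : IsPiecewisePolynomial Φ) (h' : IsPiecewisePolynomial Φ') :
    IsPiecewisePolynomial (Φ ∘ Φ') where
  bounded b := by
    obtain ⟨b', hb'⟩ := h'.bounded b
    obtain ⟨b'', hb''⟩ := h.bounded b'
    exact ⟨b'', hb''.comp hb'⟩
  polynomial b p hp := by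
    obtain ⟨b', hb'⟩ := h'.bounded b
    obtain ⟨p', hp', h₁⟩ := h.polynomial b' p hp
    obtain ⟨p'', hp'', h₂⟩ := h'.polynomial b p' hp'
    exact ⟨p'', hp'', fun g hg => (h₁ _ (hb' hg)).trans (h₂ g hg)⟩

/-- The loop topology is the colimit topology of the pieces, so continuity is tested on each piece.
There the preimage of a basic open set `p ≠ 0` is the basic open set `p' ≠ 0`. -/
theorem IsPiecewisePolynomial.continuous {Φ : LoopGroup A → LoopGroup A}
    (h : IsPiecewisePolynomial Φ) : Continuous[loopTopology A, loopTopology A] Φ := by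
  refine continuous_iSup_dom.mpr fun b => continuous_coinduced_dom.mpr ?_
  obtain ⟨b', hb'⟩ := h.bounded b
  have hval : Continuous[boundedPieceTopology b', loopTopology A] Subtype.val :=
    continuous_iSup_rng continuous_coinduced_rng
  have hres : Continuous[boundedPieceTopology b, boundedPieceTopology b'] hb'.restrict := by
    refine continuous_generateFrom_iff.mpr ?_
    rintro _ ⟨p, hp, rfl⟩
    obtain ⟨p', hp', hpp'⟩ := h.polynomial b p hp
    refine TopologicalSpace.isOpen_generateFrom_of_mem ⟨p', hp', ?_⟩
    ext g
    exact not_congr (Eq.congr_left (hpp' g.1 g.2))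
  exact @Continuous.comp _ _ _ (boundedPieceTopology b) (boundedPieceTopology b')
    (loopTopology A) _ _ hval hres

theorem IsPiecewisePolynomial.continuous_of_lift {Φ : LoopGroup A → LoopGroup A}
    (h : IsPiecewisePolynomial Φ) {φ : Gr A → Gr A} (hφ : ∀ g, φ (toGr g) = toGr (Φ g)) :
    Continuous φ := by
  refine continuous_coinduced_dom.mpr ?_
  rw [show φ ∘ toGr = toGr ∘ Φ from funext hφ]
  exact @Continuous.comp _ _ _ (loopTopology A) (loopTopology A) _ _ _
    continuous_coinduced_rng h.continuous

/-- A local fraction `p / q` representing `F` near `Φ g` pulls back along `Φ` to a fraction of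
polynomials near `g`. -/
theorem IsRegularOn.comp_restrict {Φ : LoopGroup A → LoopGroup A}
    (h : IsPiecewisePolynomial Φ) {φ : Gr A → Gr A} (hφ : ∀ g, φ (toGr g) = toGr (Φ g))
    {Y Z : Set (Gr A)} (hYZ : Set.MapsTo φ Y Z) {V : Set Z} {F : Z → ℂ} (hF : IsRegularOn V F) :
    IsRegularOn (hYZ.restrict ⁻¹' V) (F ∘ hYZ.restrict) := by
  rintro b g hg ⟨y, hy, hyg⟩
  have lift_eq {y : Y} {g} (hyg : y.1 = toGr g) : (Set.MapsTo.restrict φ Y Z hYZ y).1 = toGr (Φ g) := by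
    rw [← hφ, ← hyg]; rfl
  obtain ⟨b', hb'⟩ := h.bounded b
  obtain ⟨p, hp, q, hq, hqg, hpq⟩ := hF b' (Φ g) (hb' hg) ⟨_, hy, lift_eq hyg⟩
  obtain ⟨p', hp', hpp'⟩ := h.polynomial b p hp
  obtain ⟨q', hq', hqq'⟩ := h.polynomial b q hq
  refine ⟨p', hp', q', hq', hqq' g hg ▸ hqg, fun k hk hqk z hz hzk => ?_⟩
  rw [← hpp' k hk, ← hqq' k hk]
  exact hpq _ (hb' hk) (by rwa [hqq' k hk]) _ hz (lift_eq hzk)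

/-- A self-map of `Gr` with a piecewise polynomial lift restricts to an isomorphism of varieties
between subsets which it maps to one another, provided it is an involution. -/
theorem IsPiecewisePolynomial.isVarietyIso_restrict {Φ : LoopGroup A → LoopGroup A}
    (h : IsPiecewisePolynomial Φ) {φ : Gr A → Gr A} (hφ : ∀ g, φ (toGr g) = toGr (Φ g))
    (hinv : Function.Involutive φ) {Y Z : Set (Gr A)}
    (hYZ : Set.MapsTo φ Y Z) (hZY : Set.MapsTo φ Z Y) : IsVarietyIso hYZ.restrict := by
  have hcont := h.continuous_of_lift hφ
  have hleft : Function.LeftInverse hZY.restrict hYZ.restrict := fun y => Subtype.ext (hinv y.1)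
  have hright : Function.RightInverse hZY.restrict hYZ.restrict := fun z => Subtype.ext (hinv z.1)
  refine ⟨(Homeomorph.mk ⟨hYZ.restrict, hZY.restrict, hleft, hright⟩ (hcont.restrict hYZ)
    (hcont.restrict hZY)).isHomeomorph, fun V _ F => ⟨.comp_restrict h hφ hYZ, fun hF => ?_⟩⟩
  -- The converse is the same pull-back along the inverse map, which is again a restriction of `φ`.
  have := IsRegularOn.comp_restrict h hφ hZY hF
  rwa [← Set.preimage_comp, Function.comp_assoc, hright.comp_eq_id, Set.preimage_id,
    Function.comp_id] at this

end PiecewisePolynomial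

/-! ### The involution exchanging the two convolution fibres -/

section Fibre

variable {A : Type*} [CommRing A] [HopfAlgebra ℂ A] {M : Type*} [AddCommGroup M]
  {T : A →ₐc[ℂ] AddMonoidAlgebra ℂ M}

theorem smul_toGr (g h : LoopGroup A) : g • toGr h = toGr (g * h) := rfl

theorem Gr.mapAut_toGr (ψ : A ≃ₐc[ℂ] A) (g : LoopGroup A) :
    Gr.mapAut ψ (toGr g) = toGr (Points.comap (ψ : A →ₐc[ℂ] A) (LaurentSeries ℂ) g) := rfl

theorem toGr_surjective : Function.Surjective (toGr : LoopGroup A → Gr A) :=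
  QuotientGroup.mk_surjective

theorem Gr.mapAut_smul (ψ : A ≃ₐc[ℂ] A) (g : LoopGroup A) (L : Gr A) :
    Gr.mapAut ψ (g • L) =
      Points.comap (ψ : A →ₐc[ℂ] A) (LaurentSeries ℂ) g • Gr.mapAut ψ L := by
  obtain ⟨h, rfl⟩ := toGr_surjective L
  rw [smul_toGr, mapAut_toGr, mapAut_toGr, smul_toGr, map_mul]

/-- An automorphism inverting the torus `T` inverts the elements `t^l`. -/
theorem comap_tPow {ψ : A ≃ₐc[ℂ] A} (hψ : ∀ a : A, T (ψ a) = HopfAlgebra.antipode ℂ (T a))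
    (l : M →+ ℤ) :
    Points.comap (ψ : A →ₐc[ℂ] A) (LaurentSeries ℂ) (tPow T l) = (tPow T l)⁻¹ := by
  rw [tPow, ← map_inv]
  refine AlgHom.ext fun a => ?_
  exact congrArg (torusElement l) (hψ a)

theorem Gr.mapAut_involutive {ψ : A ≃ₐc[ℂ] A} (hψ : ∀ a : A, ψ (ψ a) = a) :
    Function.Involutive (Gr.mapAut ψ) := by
  intro L
  obtain ⟨g, rfl⟩ := toGr_surjective L
  rw [mapAut_toGr, mapAut_toGr]
  refine congrArg toGr (AlgHom.ext fun a => ?_)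
  exact congrArg g (hψ a)

theorem HasDistance.smul {L₁ L₂ : Gr A} {l : M →+ ℤ} (h : HasDistance T L₁ L₂ l)
    (g : LoopGroup A) : HasDistance T (g • L₁) (g • L₂) l := by
  obtain ⟨k, rfl, rfl⟩ := h
  exact ⟨g * k, mul_smul _ _ _, mul_smul _ _ _⟩

/-- `d(ψ(L₂), ψ(L₁)) = d(L₁, L₂)` for an automorphism `ψ` inverting the torus `T`. -/
theorem HasDistance.mapAut {ψ : A ≃ₐc[ℂ] A}
    (hψ : ∀ a : A, T (ψ a) = HopfAlgebra.antipode ℂ (T a)) {L₁ L₂ : Gr A} {l : M →+ ℤ}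
    (h : HasDistance T L₁ L₂ l) : HasDistance T (Gr.mapAut ψ L₂) (Gr.mapAut ψ L₁) l := by
  obtain ⟨g, rfl, rfl⟩ := h
  -- This element works because `ψ(g t^l) t^l = ψ(g) t^{-l} t^l = ψ(g)`.
  refine ⟨Points.comap (ψ : A →ₐc[ℂ] A) (LaurentSeries ℂ) (g * tPow T l), ?_, ?_⟩
  · rw [smul_toGr, smul_toGr, Gr.mapAut_toGr, mul_one]
  · rw [smul_toGr, smul_toGr, Gr.mapAut_toGr, mul_one, map_mul, comap_tPow hψ,
      inv_mul_cancel_right]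

theorem tPow_smul_mapAut_tPow {ψ : A ≃ₐc[ℂ] A}
    (hψ : ∀ a : A, T (ψ a) = HopfAlgebra.antipode ℂ (T a)) (n : M →+ ℤ) :
    tPow T n • Gr.mapAut ψ (toGr (tPow T n)) = toGr 1 := by
  rw [Gr.mapAut_toGr, comap_tPow hψ, smul_toGr, mul_inv_cancel]

theorem mapsTo_convolutionFibre {ψ : A ≃ₐc[ℂ] A}
    (hψ : ∀ a : A, T (ψ a) = HopfAlgebra.antipode ℂ (T a)) (l m n : M →+ ℤ) :
    Set.MapsTo (fun L => tPow T n • Gr.mapAut ψ L)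
      (convolutionFibre T l m n) (convolutionFibre T m l n) := by
  rintro L ⟨h₁, h₂⟩
  refine ⟨?_, ?_⟩
  -- The second edge of the chain becomes the first, and vice versa.
  · have := (h₂.mapAut hψ).smul (tPow T n)
    rwa [tPow_smul_mapAut_tPow hψ] at this
  · have := (h₁.mapAut hψ).smul (tPow T n)
    rwa [Gr.mapAut_toGr, map_one, smul_toGr, mul_one] at this

theorem involutive_tPow_smul_mapAut {ψ : A ≃ₐc[ℂ] A} (hψ : ∀ a : A, ψ (ψ a) = a)
    (hψT : ∀ a : A, T (ψ a) = HopfAlgebra.antipode ℂ (T a)) (n : M →+ ℤ) :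
    Function.Involutive fun L => tPow T n • Gr.mapAut ψ L := by
  intro L
  change tPow T n • Gr.mapAut ψ (tPow T n • Gr.mapAut ψ L) = L
  rw [Gr.mapAut_smul, comap_tPow hψT, Gr.mapAut_involutive hψ, smul_inv_smul]

end Fibre

end Satake

/-! ### Transport of components and the main theorem -/

theorem Homeomorph.image_mem_irreducibleComponents {X Y : Type*} [TopologicalSpace X]
    [TopologicalSpace Y] (e : X ≃ₜ Y) {Z : Set X} (hZ : Z ∈ irreducibleComponents X) :
    e '' Z ∈ irreducibleComponents Y := by
  rw [← Homeomorph.preimage_symm]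
  exact preimage_mem_irreducibleComponents hZ e.symm.isOpenEmbedding
    (by simpa using hZ.1.1)

namespace Satake

theorem image_mem_components {A : Type*} [CommRing A] [HopfAlgebra ℂ A] {M : Type*}
    [AddCommGroup M] {T : A →ₐc[ℂ] AddMonoidAlgebra ℂ M} {B : Subgroup (Points A ℂ)}
    {l m n : M →+ ℤ} (e : convolutionFibre T l m n ≃ₜ convolutionFibre T m l n)
    {Z : Set (convolutionFibre T l m n)} (hZ : Z ∈ components T B l m n) :
    e '' Z ∈ components T B m l n := by
  obtain ⟨hZ, d, hd, hdim⟩ := hZ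
  -- The required dimension is symmetric in `l` and `m`.
  refine ⟨e.image_mem_irreducibleComponents hZ, d, ?_, by rwa [add_comm m l]⟩
  rw [← hd]
  exact ((e.image Z).isHomeomorph.topologicalKrullDim_eq _).symm

end Satake

theorem mainTheorem4
    {A : Type*} [CommRing A] [HopfAlgebra ℂ A] [Algebra.FiniteType ℂ A]
    (hG : Satake.IsSemisimpleGroup A)
    {M : Type*} [AddCommGroup M] [Module.Free ℤ M] [Module.Finite ℤ M]
    (T : A →ₐc[ℂ] AddMonoidAlgebra ℂ M) (hT : Satake.IsMaximalTorus T)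
    (B : Subgroup (Satake.Points A ℂ)) (hB : Satake.IsBorel B)
    (hTB : (Satake.Points.comap T ℂ).range ≤ B)
    (x : M → Multiplicative ℂ →* Satake.Points A ℂ)
    (hx : ∀ α ∈ Satake.roots T, Satake.IsRootSubgroup T α (x α))
    (ψ : A ≃ₐc[ℂ] A) (hψ : Satake.IsTransposeInverse T x ψ)
    (l m n : M →+ ℤ) (hl : Satake.IsDominant T B l) (hm : Satake.IsDominant T B m) :
    ∃ h : Set.MapsTo (fun L => Satake.tPow T n • Satake.Gr.mapAut ψ L)
        (Satake.convolutionFibre T l m n) (Satake.convolutionFibre T m l n),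
      Satake.IsVarietyIso h.restrict ∧
      Set.BijOn (fun Z => h.restrict '' Z)
        (Satake.components T B l m n) (Satake.components T B m l n) := by
  have hmaps := Satake.mapsTo_convolutionFibre hψ.torus
  have hiso : Satake.IsVarietyIso (hmaps l m n).restrict :=
    ((Satake.isPiecewisePolynomial_mul_left (Satake.tPow T n)).comp
      (Satake.isPiecewisePolynomial_comap (ψ : A →ₐc[ℂ] A))).isVarietyIso_restrict
      (fun _ => rfl) (Satake.involutive_tPow_smul_mapAut hψ.involutive hψ.torus n) _ (hmaps m l n)
  refine ⟨hmaps l m n, hiso, ?_⟩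
  let e := hiso.1.homeomorph
  -- Taking images under `e.symm` inverts the map on components.
  refine Set.InvOn.bijOn (f' := fun Z => e.symm '' Z) ⟨fun Z _ => ?_, fun Z _ => ?_⟩
    (fun Z => Satake.image_mem_components e) (fun Z => Satake.image_mem_components e.symm)
  · exact e.symm_image_image Z
  · exact e.image_symm_image Z
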